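/- For every odd prime $p$, $$\sum_{n=0}^{p-1}\frac{(\frac12)_n(\frac13)_n(\frac23)_n}{(1)_n^3}\,(11n+3)\left(\frac{27}{16}\right)^n\equiv 3p \pmod{p^3},$$ where $(a)_n=\prod_{k=0}^{n-1}(a+k)$ is the rising factorial; and, in terms of binomial coefficients, $$\sum_{k=0}^{p-1}\frac{11k+3}{64^k}\binom{2k}{k}^2\binom{3k}{k}\equiv 3p \pmod{p^3}.$$ Here, for rational numbers $a,b$, the congruence $a\equiv b\pmod{p^3}$ means that $a-b=p^3c$ for some rational number $c$ whose denominator in lowest terms is not divisible by $p$. -/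

import Mathlib

/-- Congruence of rational numbers modulo a positive integer `m`: the difference `a - b` is
`m` times a rational number whose (reduced) denominator is coprime to `m`. For `m = p ^ r` with
`p` prime and `r ≥ 1` this says that `a - b` lies in `p ^ r ℤ_(p)`, where `ℤ_(p)` is the ring of
rational numbers with denominator prime to `p`. -/
def RatModEq (m : ℕ) (a b : ℚ) : Prop :=
  ∃ c : ℚ, c.den.Coprime m ∧ a - b = (m : ℚ) * c

/-- The rising factorial `(a)_n = a (a + 1) ⋯ (a + n - 1)` of a rational number. -/
def poch (a : ℚ) (n : ℕ) : ℚ := ∏ k ∈ Finset.range n, (a + (k : ℚ))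

/-!
The proof is by a Wilf–Zeilberger pair. In binomial form the summand is
`(11 n + 3) * C(2n, n) ^ 2 * C(3n, n) / 64 ^ n`, and it is the value at `k = 0` of

`F(n, k) = (-1) ^ k * C(2n+2k, n+k) * C(2n-2k, n-k) * C(3n, n) * C(n-k, k) / (64 ^ n * C(2k, k))
  * (22 n ^ 2 + (17 + 10 k) n + 2 k + 3) / (2 n + 1)`,

which satisfies `F(n, k+1) - F(n, k) = G(n+1, k) - G(n, k)` for an explicit multiple `G` of the same
hypergeometric term (`wzF_sub_wzF`). Put `p = 2 h + 1`. Summing the relation over `n < p` and `k < h`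
gives `∑ F(n, 0) = ∑ F(n, h) - ∑ G(p, k)`, as `G(0, k) = 0` (`sum_wzF_zero`).

Each boundary term `G(p, k)` with `k < h` is divisible by `p ^ 3` (`ratModEq_wzG`). Since `C(n-h, h)`
vanishes for `n < 2 h = p - 1`, only the term `n = p - 1` of `∑ F(n, h)` survives, and it equals
`(-1) ^ h * 3 p * C(3p-1, p-1) * C(2(p+h), p+h) / (2 * 64 ^ (p-1))` (`wzF_pred`). It remains to show
that the cofactor of `3 p` is congruent to `1` modulo `p ^ 2`
(`exists_choose_mul_centralBinom_eq`). With `A = p * H_h`, where `H_h` is the harmonic number, one has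
`C(3p-1, p-1) = 1`, `C(2(p+h), p+h) = 2 (-1) ^ h (1 - 3 A)` and `4 ^ (p-1) = 1 - A` modulo `p ^ 2`, and
`A ^ 2 = 0`, so that `64 ^ (p-1) = 1 - 3 A`.
-/

open Finset
open scoped Nat

/-! ### Congruences between rational numbers -/

/-- To prove a congruence it suffices to exhibit the quotient as a fraction, not necessarily reduced,
whose denominator is prime to the modulus. -/
lemma RatModEq.of_sub_eq_mul_div {m : ℕ} {a b : ℚ} (z : ℤ) (d : ℕ) (hd : d.Coprime m)
    (h : a - b = m * (z / d)) : RatModEq m a b := by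
  refine ⟨z / d, Nat.Coprime.coprime_dvd_left ?_ hd, h⟩
  have := Rat.den_dvd z d
  rw [Rat.divInt_eq_div] at this
  exact_mod_cast this

lemma RatModEq.sub_right {m : ℕ} {a b c : ℚ} (h : RatModEq m a b) (hc : RatModEq m c 0) :
    RatModEq m (a - c) b := by
  obtain ⟨x, hx, hab⟩ := h
  obtain ⟨y, hy, hc⟩ := hc
  refine ⟨x - y, Nat.Coprime.coprime_dvd_left (Rat.sub_den_dvd x y) (hx.mul_left hy), ?_⟩
  linear_combination hab - hc

lemma RatModEq.sub_sum {m : ℕ} {a b : ℚ} (h : RatModEq m a b) (f : ℕ → ℚ) (N : ℕ)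
    (hf : ∀ k < N, RatModEq m (f k) 0) : RatModEq m (a - ∑ k ∈ range N, f k) b := by
  induction N with
  | zero => simpa using h
  | succ N ih =>
    rw [sum_range_succ, ← sub_sub]
    exact (ih fun k hk => hf k (by omega)).sub_right (hf N (by omega))

/-! ### The Wilf–Zeilberger pair -/

/-- The hypergeometric kernel of the Wilf–Zeilberger pair. The factor `(n - k).choose k` makes it
vanish for `n < 2 * k`, so truncated subtraction does no harm. -/
def wzKernel (n k : ℕ) : ℚ :=
  (n + k).centralBinom * (n - k).centralBinom * (3 * n).choose n * (n - k).choose k /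
    (64 ^ n * k.centralBinom)

/-- The summand `F (n, k)` of the Wilf–Zeilberger pair; `F (n, 0)` is the summand of interest. -/
def wzF (n k : ℕ) : ℚ :=
  (-1) ^ k * wzKernel n k * (22 * n ^ 2 + (17 + 10 * k) * n + 2 * k + 3) / (2 * n + 1)

/-- The companion `G (n, k)` of `wzF`: differences of `wzF` in `k` are differences of `wzG`
in `n`. -/
def wzG (n k : ℕ) : ℚ :=
  -((-1) ^ k * wzKernel n k * (16 * n ^ 2 * (n - 2 * k))) / ((2 * k + 1) * (2 * n - 2 * k - 1))

lemma wzKernel_eq_zero {n k : ℕ} (h : n < 2 * k) : wzKernel n k = 0 := by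
  simp [wzKernel, Nat.choose_eq_zero_of_lt (show n - k < k by omega)]

lemma wzKernel_eq_factorial (k m : ℕ) :
    wzKernel (2 * k + m) k = ((6 * k + 2 * m)! * (2 * k + 2 * m)! * (6 * k + 3 * m)! * k !) /
      ((3 * k + m)! ^ 2 * (k + m)! * (2 * k)! * (4 * k + 2 * m)! * (2 * k + m)! * m ! *
        64 ^ (2 * k + m)) := by
  have cb (j : ℕ) : (j.centralBinom : ℚ) = (2 * j)! / (j ! * j !) := by
    rw [Nat.centralBinom, two_mul, Nat.cast_add_choose]
  have h3 : ((3 * (2 * k + m)).choose (2 * k + m) : ℚ) =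
      (6 * k + 3 * m)! / ((2 * k + m)! * (4 * k + 2 * m)!) := by
    rw [show 3 * (2 * k + m) = (2 * k + m) + (4 * k + 2 * m) by ring, Nat.cast_add_choose,
      show (2 * k + m) + (4 * k + 2 * m) = 6 * k + 3 * m by ring]
  have hf (j : ℕ) : (j ! : ℚ) ≠ 0 := by exact_mod_cast j.factorial_ne_zero
  rw [wzKernel, show 2 * k + m - k = k + m by omega, h3, Nat.cast_add_choose, cb, cb, cb,
    show 2 * (2 * k + m + k) = 6 * k + 2 * m by ring, show 2 * k + m + k = 3 * k + m by ring,
    show 2 * (k + m) = 2 * k + 2 * m by ring]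
  field_simp [hf]

lemma wzKernel_succ_left (k m : ℕ) :
    wzKernel (2 * k + m + 1) k = wzKernel (2 * k + m) k *
      (3 * (6 * k + 2 * m + 1) * (2 * k + 2 * m + 1) * (6 * k + 3 * m + 1) * (6 * k + 3 * m + 2)) /
      (32 * (3 * k + m + 1) * (4 * k + 2 * m + 1) * (2 * k + m + 1) * (m + 1)) := by
  have hf (j : ℕ) : (j ! : ℚ) ≠ 0 := by exact_mod_cast j.factorial_ne_zero
  rw [add_assoc, wzKernel_eq_factorial, wzKernel_eq_factorial,
    show 6 * k + 2 * (m + 1) = 6 * k + 2 * m + 1 + 1 by ring,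
    show 2 * k + 2 * (m + 1) = 2 * k + 2 * m + 1 + 1 by ring,
    show 6 * k + 3 * (m + 1) = 6 * k + 3 * m + 1 + 1 + 1 by ring,
    show 4 * k + 2 * (m + 1) = 4 * k + 2 * m + 1 + 1 by ring]
  simp only [← add_assoc, Nat.factorial_succ]
  push_cast
  field_simp [hf]
  ring

/-- For `m < 2` both sides vanish, the right one because of the factor `m * (m - 1)`. -/
lemma wzKernel_succ_right (k m : ℕ) :
    wzKernel (2 * k + m) (k + 1) = wzKernel (2 * k + m) k *
      ((6 * k + 2 * m + 1) * m * (m - 1)) /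
      (2 * (2 * k + 2 * m - 1) * (3 * k + m + 1) * (2 * k + 1)) := by
  have hf (j : ℕ) : (j ! : ℚ) ≠ 0 := by exact_mod_cast j.factorial_ne_zero
  match m with
  | 0 => rw [wzKernel_eq_zero (by omega)]; simp
  | 1 => rw [wzKernel_eq_zero (by omega)]; simp
  | m + 2 =>
    have h2 : (2 * k + 2 * ((m + 2 : ℕ) : ℚ) - 1) = 2 * k + 2 * m + 3 := by push_cast; ring
    rw [h2, wzKernel_eq_factorial, show 2 * k + (m + 2) = 2 * (k + 1) + m by ring,
      wzKernel_eq_factorial,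
      show 6 * (k + 1) + 2 * m = 6 * k + 2 * m + 1 + 1 + 1 + 1 + 1 + 1 by ring,
      show 6 * k + 2 * (m + 2) = 6 * k + 2 * m + 1 + 1 + 1 + 1 by ring,
      show 2 * (k + 1) + 2 * m = 2 * k + 2 * m + 1 + 1 by ring,
      show 2 * k + 2 * (m + 2) = 2 * k + 2 * m + 1 + 1 + 1 + 1 by ring,
      show 6 * (k + 1) + 3 * m = 6 * k + 3 * (m + 2) by ring,
      show 3 * (k + 1) + m = 3 * k + m + 1 + 1 + 1 by ring,
      show 3 * k + (m + 2) = 3 * k + m + 1 + 1 by ring,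
      show k + (m + 2) = k + m + 1 + 1 by ring,
      show k + 1 + m = k + m + 1 by ring,
      show 4 * (k + 1) + 2 * m = 4 * k + 2 * (m + 2) by ring,
      show 2 * (k + 1) + m = 2 * k + (m + 2) by ring,
      show 2 * (k + 1) = 2 * k + 1 + 1 by ring]
    simp only [Nat.factorial_succ (6 * k + 2 * m + 1 + 1 + 1 + 1 + 1),
      Nat.factorial_succ (6 * k + 2 * m + 1 + 1 + 1 + 1),
      Nat.factorial_succ (2 * k + 2 * m + 1 + 1 + 1), Nat.factorial_succ (2 * k + 2 * m + 1 + 1),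
      Nat.factorial_succ (3 * k + m + 1 + 1), Nat.factorial_succ (k + m + 1),
      Nat.factorial_succ (2 * k + 1), Nat.factorial_succ (2 * k), Nat.factorial_succ k,
      Nat.factorial_succ (m + 1), Nat.factorial_succ m]
    push_cast
    field_simp [hf]
    ring

/-- The Wilf–Zeilberger relation. It holds for all `n` and `k`: on the boundary `n + 1 = 2 * k` of
the support the factor `n - 2 * k` of `wzG` vanishes. -/
theorem wzF_sub_wzF (n k : ℕ) : wzF n (k + 1) - wzF n k = wzG (n + 1) k - wzG n k := by
  rcases lt_or_ge n (2 * k) with h | h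
  · have h0 : wzG (n + 1) k = 0 := by
      rcases (show n + 1 < 2 * k ∨ n + 1 = 2 * k by omega) with h' | h'
      · simp [wzG, wzKernel_eq_zero h']
      · have : ((n + 1 : ℕ) : ℚ) - 2 * k = 0 := by rw [h']; push_cast; ring
        rw [wzG, this]; simp
    rw [h0]
    simp [wzF, wzG, wzKernel_eq_zero h, wzKernel_eq_zero (show n < 2 * (k + 1) by omega)]
  · obtain ⟨m, rfl⟩ := Nat.exists_eq_add_of_le h
    -- This denominator may be negative (at `n = k = 0`), but it is odd.
    have h1 : (2 * (k + m) - 1 : ℚ) ≠ 0 := by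
      have : (2 * (k + m) - 1 : ℤ) ≠ 0 := by omega
      exact_mod_cast this
    rw [wzF, wzF, wzG, wzG, wzKernel_succ_left, wzKernel_succ_right]
    push_cast
    rw [show (2 * (2 * k + m : ℚ) - 2 * k - 1) = 2 * (k + m) - 1 by ring,
      show (2 * k + 2 * m - 1 : ℚ) = 2 * (k + m) - 1 by ring,
      show (2 * (2 * k + m + 1 : ℚ) - 2 * k - 1) = 2 * k + 2 * m + 1 by ring,
      show (2 * (2 * k + m : ℚ) + 1) = 4 * k + 2 * m + 1 by ring]
    field_simp
    ring

/-- Summing the Wilf–Zeilberger relation over `n < p` and then over `k < h`. -/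
theorem sum_wzF_zero (p h : ℕ) :
    ∑ n ∈ range p, wzF n 0 = ∑ n ∈ range p, wzF n h - ∑ k ∈ range h, wzG p k := by
  have h0 (k : ℕ) : wzG 0 k = 0 := by simp [wzG]
  have step (k : ℕ) : wzG p k = ∑ n ∈ range p, wzF n (k + 1) - ∑ n ∈ range p, wzF n k := by
    rw [← sum_sub_distrib, sum_congr rfl fun n _ => wzF_sub_wzF n k,
      sum_range_sub (fun n => wzG n k), h0, sub_zero]
  rw [sum_congr rfl fun k _ => step k, sum_range_sub (fun k => ∑ n ∈ range p, wzF n k)]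
  ring

lemma wzF_zero (n : ℕ) :
    wzF n 0 = (11 * n + 3) / 64 ^ n * ((2 * n).choose n) ^ 2 * (3 * n).choose n := by
  have : (2 * n + 1 : ℚ) ≠ 0 := by positivity
  simp only [wzF, wzKernel, Nat.centralBinom, add_zero, Nat.sub_zero, Nat.choose_zero_right]
  field_simp
  push_cast
  ring

/-! ### Congruences modulo `p ^ 2` -/

/-- First-order expansion of a product along an element of square zero. -/
lemma prod_add_mul_of_sq_eq_zero {R : Type*} [CommRing R] {π : R} (hπ : π ^ 2 = 0) (c : R)
    (u v : ℕ → R) (N : ℕ) (huv : ∀ i < N, u i * v i = 1) :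
    ∏ i ∈ range N, (c * π + u i) = (∏ i ∈ range N, u i) * (1 + c * (π * ∑ i ∈ range N, v i)) := by
  induction N with
  | zero => simp
  | succ N ih =>
    rw [prod_range_succ, prod_range_succ, sum_range_succ, ih fun i hi => huv i (by omega)]
    linear_combination (∏ i ∈ range N, u i) * (c ^ 2 * (∑ i ∈ range N, v i)) * hπ -
      (∏ i ∈ range N, u i) * c * π * huv N (by omega)

lemma sum_range_two_mul_alternating {R : Type*} [CommRing R] (f : ℕ → R) (h : ℕ) :
    ∑ i ∈ range (2 * h), (-1) ^ i * f (i + 1) =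
      ∑ i ∈ range (2 * h), f (i + 1) - ∑ i ∈ range h, 2 * f (2 * (i + 1)) := by
  induction h with
  | zero => simp
  | succ h ih =>
    rw [show 2 * (h + 1) = 2 * h + 1 + 1 by ring]
    simp only [sum_range_succ, ih, pow_succ, pow_mul]
    rw [show 2 * (h + 1) = 2 * h + 1 + 1 by ring]
    simp
    ring

/-- For a prime `p`, the binomial coefficients `(p - 1).choose i` alternate modulo `p`; multiplied
by `p` this is a statement modulo `p ^ 2`. -/
lemma mul_choose_pred_zmod_sq {p : ℕ} (hp : p.Prime) {i : ℕ} (hi : i < p) :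
    (p * (p - 1).choose i : ZMod (p ^ 2)) = p * (-1) ^ i := by
  induction i with
  | zero => simp
  | succ i ih =>
    obtain ⟨c, hc⟩ : p ∣ p.choose (i + 1) := hp.dvd_choose_self (by omega) hi
    have h1 : (p - 1).choose i + (p - 1).choose (i + 1) = p * c := by
      rw [← hc, ← Nat.choose_succ_succ', Nat.sub_add_cancel hp.pos]
    have h2 : ((p - 1).choose i + (p - 1).choose (i + 1) : ZMod (p ^ 2)) = p * c := by
      exact_mod_cast congrArg (Nat.cast : ℕ → ZMod (p ^ 2)) h1
    have hπ : (p : ZMod (p ^ 2)) ^ 2 = 0 := by exact_mod_cast ZMod.natCast_self (p ^ 2)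
    rw [pow_succ (-1 : ZMod (p ^ 2)) i]
    linear_combination p * h2 - ih (by omega) + c * hπ

lemma natCast_mul_inv_zmod_sq {p : ℕ} (hp : p.Prime) {j : ℕ} (h0 : 0 < j) (hj : j < p) :
    (j : ZMod (p ^ 2)) * (j : ZMod (p ^ 2))⁻¹ = 1 :=
  ZMod.coe_mul_inv_eq_one j (((Nat.coprime_of_lt_prime h0.ne' hj hp)).symm.pow_right 2)

/-- The prime `p` times the harmonic number `H_N`, as a residue modulo `p ^ 2`. -/
def primeMulHarmonic (p N : ℕ) : ZMod (p ^ 2) :=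
  p * ∑ i ∈ range N, ((i + 1 : ℕ) : ZMod (p ^ 2))⁻¹

lemma primeMulHarmonic_sq (p N : ℕ) : primeMulHarmonic p N ^ 2 = 0 := by
  have hπ : (p : ZMod (p ^ 2)) ^ 2 = 0 := by exact_mod_cast ZMod.natCast_self (p ^ 2)
  rw [primeMulHarmonic, mul_pow, hπ, zero_mul]

/-- The terms of `H_(p-1)` of index `j` and `p - j` add up to a multiple of `p`. -/
lemma primeMulHarmonic_pred {p : ℕ} (hp : p.Prime) (hp2 : 2 < p) :
    primeMulHarmonic p (p - 1) = 0 := by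
  have hπ : (p : ZMod (p ^ 2)) ^ 2 = 0 := by exact_mod_cast ZMod.natCast_self (p ^ 2)
  have h2 := natCast_mul_inv_zmod_sq hp two_pos hp2
  have key : primeMulHarmonic p (p - 1) + primeMulHarmonic p (p - 1) = 0 := by
    rw [primeMulHarmonic]
    nth_rw 2 [← sum_range_reflect]
    rw [← mul_add, ← sum_add_distrib, mul_sum]
    refine sum_eq_zero fun i hi => ?_
    rw [mem_range] at hi
    have hx := natCast_mul_inv_zmod_sq hp (j := i + 1) (by omega) (by omega)
    have hy := natCast_mul_inv_zmod_sq hp (j := p - 1 - 1 - i + 1) (by omega) (by omega)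
    have hxy : ((i + 1 : ℕ) : ZMod (p ^ 2)) + (p - 1 - 1 - i + 1 : ℕ) = p := by
      rw [← Nat.cast_add]; congr 1; omega
    generalize ((i + 1 : ℕ) : ZMod (p ^ 2)) = x at *
    generalize ((p - 1 - 1 - i + 1 : ℕ) : ZMod (p ^ 2)) = y at *
    linear_combination (-p * y⁻¹) * hx - p * x⁻¹ * hy + p * x⁻¹ * y⁻¹ * hxy + x⁻¹ * y⁻¹ * hπ
  push_cast at h2
  linear_combination (2 : ZMod (p ^ 2))⁻¹ * key - primeMulHarmonic p (p - 1) * h2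

/-- The products `(c p + 1) ⋯ (c p + N)` modulo `p ^ 2`. -/
lemma prod_mul_add_zmod_sq {p : ℕ} (hp : p.Prime) (c : ZMod (p ^ 2)) {N : ℕ} (hN : N < p) :
    ∏ i ∈ range N, (c * p + (i + 1 : ℕ)) =
      (N ! : ZMod (p ^ 2)) * (1 + c * primeMulHarmonic p N) := by
  have hπ : (p : ZMod (p ^ 2)) ^ 2 = 0 := by exact_mod_cast ZMod.natCast_self (p ^ 2)
  rw [prod_add_mul_of_sq_eq_zero hπ c (fun i => ((i + 1 : ℕ) : ZMod (p ^ 2))) _ N fun i hi =>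
    natCast_mul_inv_zmod_sq hp i.succ_pos (by omega), ← Nat.cast_prod,
    prod_range_add_one_eq_factorial]
  rfl

lemma ascFactorial_zmod_sq {p : ℕ} (hp : p.Prime) (c : ℕ) {N : ℕ} (hN : N < p) :
    ((c * p + 1).ascFactorial N : ZMod (p ^ 2)) = N ! * (1 + c * primeMulHarmonic p N) := by
  rw [← prod_mul_add_zmod_sq hp c hN, Nat.ascFactorial_eq_prod_range]
  push_cast
  exact prod_congr rfl fun i _ => by ring

lemma isUnit_natCast_zmod_sq {p j : ℕ} (h : j.Coprime p) : IsUnit (j : ZMod (p ^ 2)) :=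
  (ZMod.isUnit_iff_coprime j _).2 (h.pow_right 2)

lemma isUnit_factorial_zmod_sq {p : ℕ} (hp : p.Prime) {N : ℕ} (hN : N < p) :
    IsUnit (N ! : ZMod (p ^ 2)) :=
  isUnit_natCast_zmod_sq (hp.coprime_factorial_of_lt hN).symm

/-- Fermat quotients and harmonic numbers: `4 ^ (p - 1) ≡ 1 - p H_((p-1)/2)` modulo `p ^ 2`, from
the binomial expansion of `(1 + 1) ^ p`. -/
lemma four_pow_zmod_sq {p h : ℕ} (hp : p.Prime) (hpe : p = 2 * h + 1) :
    (4 : ZMod (p ^ 2)) ^ (2 * h) = 1 - primeMulHarmonic p h := by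
  have hh : 2 < p := by have := hp.two_le; omega
  have hsum : (2 : ZMod (p ^ 2)) ^ p = 2 - primeMulHarmonic p h := by
    have h1 : (2 : ZMod (p ^ 2)) ^ p =
        ∑ i ∈ range (2 * h), (p.choose (i + 1) : ZMod (p ^ 2)) + 2 := by
      have e : 2 ^ p = ∑ i ∈ range (2 * h), p.choose (i + 1) + 2 := by
        rw [← Nat.sum_range_choose p, sum_range_succ,
          show range p = range (2 * h + 1) by rw [hpe], sum_range_succ']
        simp
      exact_mod_cast congrArg (Nat.cast : ℕ → ZMod (p ^ 2)) e
    have h2 : ∀ i ∈ range (2 * h), (p.choose (i + 1) : ZMod (p ^ 2)) =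
        p * ((-1) ^ i * ((i + 1 : ℕ) : ZMod (p ^ 2))⁻¹) := by
      intro i hi
      rw [mem_range] at hi
      have e := Nat.add_one_mul_choose_eq (p - 1) i
      rw [Nat.sub_add_cancel hp.pos] at e
      have e' : (p : ZMod (p ^ 2)) * (p - 1).choose i = p.choose (i + 1) * (i + 1 : ℕ) := by
        exact_mod_cast congrArg (Nat.cast : ℕ → ZMod (p ^ 2)) e
      have hx := natCast_mul_inv_zmod_sq hp (j := i + 1) (by omega) (by omega)
      have hc := mul_choose_pred_zmod_sq hp (i := i) (by omega)
      generalize ((i + 1 : ℕ) : ZMod (p ^ 2)) = x at *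
      linear_combination (-(p.choose (i + 1) : ZMod (p ^ 2))) * hx - x⁻¹ * e' + x⁻¹ * hc
    have h3 : ∀ i ∈ range h, (2 * ((2 * (i + 1) : ℕ) : ZMod (p ^ 2))⁻¹) =
        ((i + 1 : ℕ) : ZMod (p ^ 2))⁻¹ := by
      intro i hi
      rw [mem_range] at hi
      have hx := natCast_mul_inv_zmod_sq hp (j := i + 1) (by omega) (by omega)
      have hy := natCast_mul_inv_zmod_sq hp (j := 2 * (i + 1)) (by omega) (by omega)
      have hxy : ((2 * (i + 1) : ℕ) : ZMod (p ^ 2)) = 2 * (i + 1 : ℕ) := by push_cast; ring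
      generalize ((i + 1 : ℕ) : ZMod (p ^ 2)) = x at *
      generalize ((2 * (i + 1) : ℕ) : ZMod (p ^ 2)) = y at *
      linear_combination (-2 * y⁻¹) * hx + x⁻¹ * hy - x⁻¹ * y⁻¹ * hxy
    have h4 := primeMulHarmonic_pred hp hh
    rw [primeMulHarmonic, show p - 1 = 2 * h by omega] at h4
    rw [h1, sum_congr rfl h2, ← mul_sum,
      sum_range_two_mul_alternating (fun j => ((j : ℕ) : ZMod (p ^ 2))⁻¹), sum_congr rfl h3, mul_sub,
      h4, primeMulHarmonic]
    ring
  have h4 : IsUnit (4 : ZMod (p ^ 2)) := by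
    have : Nat.Coprime 4 p := by
      rw [hpe]
      exact Nat.Coprime.pow_left 2 (show Nat.Coprime 2 (2 * h + 1) by simp)
    exact_mod_cast isUnit_natCast_zmod_sq this
  refine h4.mul_left_cancel ?_
  have h5 : (2 : ZMod (p ^ 2)) ^ p = 2 * 2 ^ (2 * h) := by
    rw [← pow_succ', ← hpe]
  have h6 : (4 : ZMod (p ^ 2)) ^ (2 * h) = (2 ^ (2 * h)) ^ 2 := by
    rw [← pow_mul, mul_comm (2 * h) 2, pow_mul 2 2]; norm_num
  rw [h5] at hsum
  rw [h6]
  linear_combination (2 * 2 ^ (2 * h) + (2 - primeMulHarmonic p h)) * hsum +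
    primeMulHarmonic_sq p h

/-- Wolstenholme's congruence, in its form modulo `p ^ 2`. -/
lemma choose_pred_zmod_sq {p : ℕ} (hp : p.Prime) (hp2 : 2 < p) (c : ℕ) :
    ((c * p + (p - 1)).choose (p - 1) : ZMod (p ^ 2)) = 1 := by
  have hlt : p - 1 < p := Nat.sub_lt hp.pos one_pos
  refine (isUnit_factorial_zmod_sq hp hlt).mul_left_cancel ?_
  have e : (c * p + 1).ascFactorial (p - 1) = (p - 1)! * (c * p + (p - 1)).choose (p - 1) :=
    Nat.ascFactorial_eq_factorial_mul_choose _ _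
  rw [← Nat.cast_mul, ← e, ascFactorial_zmod_sq hp c hlt, primeMulHarmonic_pred hp hp2]
  simp

/-- The products `(p - 1)(p - 2) ⋯ (p - h)` complete `h!` to `(p - 1)!`. -/
lemma factorial_pred_zmod_sq {p h : ℕ} (hp : p.Prime) (hpe : p = 2 * h + 1) :
    ((p - 1)! : ZMod (p ^ 2)) = (-1) ^ h * (h !) ^ 2 * (1 - primeMulHarmonic p h) := by
  have e : (p - 1)! = h ! * ∏ i ∈ range h, (p - (i + 1)) := by
    rw [show p - 1 = h + h by omega, ← Nat.factorial_mul_ascFactorial,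
      Nat.ascFactorial_eq_prod_range, ← prod_range_reflect]
    congr 1
    refine prod_congr rfl fun i hi => ?_
    rw [mem_range] at hi
    omega
  have e2 : ((∏ i ∈ range h, (p - (i + 1)) : ℕ) : ZMod (p ^ 2)) =
      (-1) ^ h * ∏ i ∈ range h, ((-1 : ZMod (p ^ 2)) * p + (i + 1 : ℕ)) := by
    rw [Nat.cast_prod, ← card_range h, ← prod_const, card_range, ← prod_mul_distrib]
    refine prod_congr rfl fun i hi => ?_
    rw [mem_range] at hi
    rw [Nat.cast_sub (by omega)]
    ring
  rw [e, Nat.cast_mul, e2, prod_mul_add_zmod_sq hp (-1) (by omega)]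
  ring

/-- A weak form of Morley's congruence for the central binomial coefficient of `3 p - 1`. -/
lemma centralBinom_zmod_sq {p h : ℕ} (hp : p.Prime) (hpe : p = 2 * h + 1) :
    ((p + h).centralBinom : ZMod (p ^ 2)) = 2 * (-1) ^ h * (1 - 3 * primeMulHarmonic p h) := by
  have hp2 : 2 < p := by have := hp.two_le; omega
  have hlt : p - 1 < p := Nat.sub_lt hp.pos one_pos
  have hN : (p + h).centralBinom * ((p - 1)! * (p + 1).ascFactorial h ^ 2) =
      2 * ((p + 1).ascFactorial (p - 1) * (2 * p + 1).ascFactorial (p - 1)) := by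
    have e0 : p ! = p * (p - 1)! := (Nat.mul_factorial_pred hp.ne_zero).symm
    have e1 : (p + h)! = p ! * (p + 1).ascFactorial h := (Nat.factorial_mul_ascFactorial _ _).symm
    have e2 : (2 * p)! = 2 * p * (p ! * (p + 1).ascFactorial (p - 1)) := by
      rw [Nat.factorial_mul_ascFactorial, ← Nat.mul_factorial_pred (by omega)]
      congr 2
      omega
    have e3 : (2 * (p + h))! = (2 * p)! * (2 * p + 1).ascFactorial (p - 1) := by
      rw [Nat.factorial_mul_ascFactorial]
      congr 1
      omega
    have e4 : (p + h).centralBinom * ((p + h)! * (p + h)!) = (2 * (p + h))! := by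
      have := Nat.choose_mul_factorial_mul_factorial (show p + h ≤ 2 * (p + h) by omega)
      rw [show 2 * (p + h) - (p + h) = p + h by omega, mul_assoc] at this
      exact this
    -- Both sides of `e4` contain `p` exactly twice; these factors are cancelled before reduction.
    refine Nat.eq_of_mul_eq_mul_left (show 0 < p ^ 2 * (p - 1)! from
      Nat.mul_pos (pow_pos hp.pos 2) (Nat.factorial_pos _)) ?_
    rw [e1, e3, e2, e0] at e4
    linear_combination e4
  have hZ : ((p + h).centralBinom : ZMod (p ^ 2)) * ((p - 1)! *
      (h ! * (1 + primeMulHarmonic p h)) ^ 2) = 2 * ((p - 1)! * (p - 1)!) := by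
    have a1 := ascFactorial_zmod_sq hp 1 (show h < p by omega)
    have a2 := ascFactorial_zmod_sq hp 1 hlt
    have a3 := ascFactorial_zmod_sq hp 2 hlt
    rw [primeMulHarmonic_pred hp hp2] at a2 a3
    simp only [one_mul, Nat.cast_one, mul_zero, add_zero, mul_one] at a1 a2 a3
    have := congrArg (Nat.cast : ℕ → ZMod (p ^ 2)) hN
    push_cast [a1, a2, a3] at this
    exact this
  have hA := primeMulHarmonic_sq p h
  have hc := (isUnit_factorial_zmod_sq hp hlt).mul_left_cancel
    (show ((p - 1)! : ZMod (p ^ 2)) * ((p + h).centralBinom *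
      (h ! * (1 + primeMulHarmonic p h)) ^ 2) = (p - 1)! * (2 * (p - 1)!) by
        linear_combination hZ)
  rw [factorial_pred_zmod_sq hp hpe] at hc
  have hc' := ((isUnit_factorial_zmod_sq hp (show h < p by omega)).pow 2).mul_left_cancel
    (show (h ! : ZMod (p ^ 2)) ^ 2 * ((p + h).centralBinom * (1 + primeMulHarmonic p h) ^ 2) =
      (h !) ^ 2 * (2 * (-1) ^ h * (1 - primeMulHarmonic p h)) by linear_combination hc)
  generalize primeMulHarmonic p h = A at *
  generalize ((p + h).centralBinom : ZMod (p ^ 2)) = C at *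
  linear_combination (1 - 2 * A) * hc' + (3 * C + 2 * A * C + 4 * (-1) ^ h) * hA

/-- The congruence modulo `p ^ 2` satisfied by the one surviving value of `wzF`. -/
theorem exists_choose_mul_centralBinom_eq {p h : ℕ} (hp : p.Prime) (hpe : p = 2 * h + 1) :
    ∃ z : ℤ, (-1) ^ h * ((3 * p - 1).choose (p - 1) * (p + h).centralBinom : ℤ) =
      2 * 64 ^ (p - 1) + p ^ 2 * z := by
  have hp2 : 2 < p := by have := hp.two_le; omega
  suffices h0 : (((-1) ^ h * ((3 * p - 1).choose (p - 1) * (p + h).centralBinom : ℤ) -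
      2 * 64 ^ (p - 1) : ℤ) : ZMod (p ^ 2)) = 0 by
    obtain ⟨z, hz⟩ := (ZMod.intCast_zmod_eq_zero_iff_dvd _ _).1 h0
    exact ⟨z, by push_cast at hz; linear_combination hz⟩
  have h4 := four_pow_zmod_sq hp hpe
  have h64 : (64 : ZMod (p ^ 2)) ^ (p - 1) = (4 ^ (2 * h)) ^ 3 := by
    rw [← pow_mul, mul_comm (2 * h) 3, pow_mul 4 3, show p - 1 = 2 * h by omega]; norm_num
  have hC := choose_pred_zmod_sq hp hp2 2
  rw [show 2 * p + (p - 1) = 3 * p - 1 by omega] at hC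
  have hsq : ((-1 : ZMod (p ^ 2)) ^ h) ^ 2 = 1 := by rw [← pow_mul, mul_comm, pow_mul]; simp
  push_cast
  rw [hC, centralBinom_zmod_sq hp hpe, h64, h4]
  have hA := primeMulHarmonic_sq p h
  generalize primeMulHarmonic p h = A at *
  linear_combination (2 * (1 - 3 * A)) * hsq + (2 * A - 6) * hA

/-! ### Evaluation modulo `p ^ 3` -/

/-- For `k < (p - 1) / 2` the denominators in `wzG p k` are prime to `p`, while its numerator
contains `p ^ 2` and one more factor `p`, from `p - 2 * k` if `k = 0` and from the central
binomial coefficient of `2 * (p - k)` otherwise. -/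
lemma ratModEq_wzG {p k : ℕ} (hp : p.Prime) (hk : 2 * k + 2 < p) :
    RatModEq (p ^ 3) (wzG p k) 0 := by
  obtain ⟨c, hc⟩ : (p : ℤ) ∣ ((p : ℤ) - 2 * k) * (p - k).centralBinom := by
    rcases k.eq_zero_or_pos with rfl | hk0
    · simp
    · refine Dvd.dvd.mul_left (Int.natCast_dvd_natCast.2 ?_) _
      rw [Nat.centralBinom]
      exact hp.dvd_choose (by omega) (by omega) (by omega)
  have hcop {j : ℕ} (h0 : 0 < j) (hj : j < p) : j.Coprime p :=
    (Nat.coprime_of_lt_prime h0.ne' hj hp).symm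
  have h64 : (64 ^ p).Coprime p :=
    Nat.Coprime.pow_left _ (Nat.Coprime.pow_left 6 (hcop two_pos (by omega)))
  have hcb : k.centralBinom.Coprime p := by
    refine ((hp.coprime_iff_not_dvd).2 fun h => ?_).symm
    have := (hp.dvd_factorial (n := 2 * k)).1 (h.trans ?_)
    · omega
    · rw [← Nat.choose_mul_factorial_mul_factorial (show k ≤ 2 * k by omega), mul_assoc]
      exact dvd_mul_right _ _
  have hlast : (2 * p - 2 * k - 1).Coprime p := by
    have : 2 * p - 2 * k - 1 = p + (p - 2 * k - 1) := by omega
    rw [this, Nat.coprime_self_add_left]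
    exact hcop (by omega) (by omega)
  refine RatModEq.of_sub_eq_mul_div
    (-((-1) ^ k * 16 * c * (p + k).centralBinom * (3 * p).choose p * (p - k).choose k))
    (64 ^ p * k.centralBinom * (2 * k + 1) * (2 * p - 2 * k - 1))
    ((((h64.mul_left hcb).mul_left (hcop (by omega) (by omega))).mul_left hlast).pow_right 3) ?_
  have hc' : ((p : ℚ) - 2 * k) * (p - k).centralBinom = p * c := by exact_mod_cast hc
  have hd : ((2 * p - 2 * k - 1 : ℕ) : ℚ) = 2 * p - 2 * k - 1 := by
    rw [Nat.cast_sub (by omega), Nat.cast_sub (by omega)]; push_cast; ring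
  have hd0 : (2 * p - 2 * k - 1 : ℚ) ≠ 0 := by
    rw [← hd]; exact_mod_cast (show 2 * p - 2 * k - 1 ≠ 0 by omega)
  have hk0 : (k.centralBinom : ℚ) ≠ 0 := by exact_mod_cast k.centralBinom_ne_zero
  rw [wzG, wzKernel]
  push_cast
  rw [hd]
  generalize (2 * p - 2 * k - 1 : ℚ) = d at *
  field_simp
  linear_combination (-(16 : ℚ) * p ^ 2 * (-1) ^ k * (p + k).centralBinom * (3 * p).choose p *
    (p - k).choose k) * hc'

/-- The value of `wzF` at `n = p - 1 = 2 * h`, `k = h`, where the polynomial factor becomes the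
square `3 * (3 * p - 2) ^ 2` and is absorbed by the binomial coefficients. -/
lemma wzF_pred {p h : ℕ} (hpe : p = 2 * h + 1) :
    wzF (p - 1) h = (-1) ^ h * (3 * p * (3 * p - 1).choose (p - 1) * (p + h).centralBinom) /
      (2 * 64 ^ (p - 1)) := by
  have e1 : ((3 * h + 1 : ℕ) : ℚ) * (3 * h + 1).centralBinom =
      2 * (2 * (3 * h : ℕ) + 1) * (3 * h).centralBinom := by
    exact_mod_cast Nat.succ_mul_centralBinom_succ (3 * h)
  have e2 : ((6 * h + 2).choose (2 * h) : ℚ) * ((4 * h + 1) * (4 * h + 2)) =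
      (6 * h).choose (2 * h) * ((6 * h + 1) * (6 * h + 2)) := by
    have a := Nat.choose_mul_succ_eq (6 * h) (2 * h)
    have b := Nat.choose_mul_succ_eq (6 * h + 1) (2 * h)
    rw [show 6 * h + 1 - 2 * h = 4 * h + 1 by omega] at a
    rw [show 6 * h + 1 + 1 - 2 * h = 4 * h + 2 by omega] at b
    have a' : ((6 * h).choose (2 * h) : ℚ) * (6 * h + 1) =
      (6 * h + 1).choose (2 * h) * (4 * h + 1) := by exact_mod_cast a
    have b' : ((6 * h + 1).choose (2 * h) : ℚ) * (6 * h + 1 + 1) =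
      (6 * h + 2).choose (2 * h) * (4 * h + 2) := by exact_mod_cast b
    linear_combination (-(6 * h + 2) : ℚ) * a' - (4 * h + 1) * b'
  have hk0 : (h.centralBinom : ℚ) ≠ 0 := by exact_mod_cast h.centralBinom_ne_zero
  subst hpe
  rw [wzF, wzKernel, show 2 * h + 1 - 1 = 2 * h by omega, show 2 * h - h = h by omega,
    show 2 * h + h = 3 * h by omega, show 3 * (2 * h) = 6 * h by omega,
    show 3 * (2 * h + 1) - 1 = 6 * h + 2 by omega, show 2 * h + 1 + h = 3 * h + 1 by omega,
    Nat.choose_self]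
  have e1' : ((3 * h + 1).centralBinom : ℚ) =
      2 * (6 * h + 1) * (3 * h).centralBinom / (3 * h + 1) := by
    rw [eq_div_iff (by positivity)]; push_cast at e1; linear_combination e1
  have e2' : ((6 * h + 2).choose (2 * h) : ℚ) =
      (6 * h).choose (2 * h) * ((6 * h + 1) * (6 * h + 2)) / ((4 * h + 1) * (4 * h + 2)) := by
    rw [eq_div_iff (by positivity)]; exact e2
  rw [e1', e2']
  push_cast
  have h4 : (2 * (2 * h : ℚ) + 1) = 4 * h + 1 := by ring
  rw [h4]
  field_simp
  ring

theorem ratModEq_sum_wzF_zero {p : ℕ} (hp : p.Prime) (hp2 : 2 < p) :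
    RatModEq (p ^ 3) (∑ n ∈ range p, wzF n 0) (3 * p) := by
  obtain ⟨h, hpe⟩ : ∃ h, p = 2 * h + 1 := hp.odd_of_ne_two hp2.ne'
  have hsum : ∑ n ∈ range p, wzF n h = wzF (p - 1) h := by
    refine sum_eq_single_of_mem _ (mem_range.2 (by omega)) fun n hn hne => ?_
    rw [mem_range] at hn
    simp [wzF, wzKernel_eq_zero (show n < 2 * h by omega)]
  rw [sum_wzF_zero p h, hsum]
  refine RatModEq.sub_sum ?_ _ _ fun k hk => ratModEq_wzG hp (by omega)
  obtain ⟨z, hz⟩ := exists_choose_mul_centralBinom_eq hp hpe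
  have h2 : Nat.Coprime 2 p := ((Nat.coprime_primes Nat.prime_two hp).2 hp2.ne)
  refine RatModEq.of_sub_eq_mul_div (3 * z) (2 * 64 ^ (p - 1))
    ((h2.mul_left (Nat.Coprime.pow_left _ (Nat.Coprime.pow_left 6 h2))).pow_right 3) ?_
  have hz' : (-1) ^ h * ((3 * p - 1).choose (p - 1) * (p + h).centralBinom : ℚ) =
      2 * 64 ^ (p - 1) + p ^ 2 * z := by exact_mod_cast hz
  rw [wzF_pred hpe]
  push_cast
  field_simp
  linear_combination hz'

/-! ### Rising factorials -/

lemma poch_succ (a : ℚ) (n : ℕ) : poch a (n + 1) = poch a n * (a + n) :=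
  prod_range_succ _ _

lemma poch_one (n : ℕ) : poch 1 n = n ! := by
  induction n with
  | zero => simp [poch]
  | succ n ih => rw [poch_succ, ih, Nat.factorial_succ]; push_cast; ring

lemma poch_half (n : ℕ) : poch (1 / 2) n = (2 * n)! / (4 ^ n * n !) := by
  induction n with
  | zero => simp [poch]
  | succ n ih =>
    have hf : (n ! : ℚ) ≠ 0 := by exact_mod_cast n.factorial_ne_zero
    rw [poch_succ, ih, show 2 * (n + 1) = 2 * n + 1 + 1 by ring]
    simp only [Nat.factorial_succ]
    push_cast
    field_simp
    ring

lemma poch_third_mul_poch_two_thirds (n : ℕ) :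
    poch (1 / 3) n * poch (2 / 3) n = (3 * n)! / (27 ^ n * n !) := by
  induction n with
  | zero => simp [poch]
  | succ n ih =>
    have hf : (n ! : ℚ) ≠ 0 := by exact_mod_cast n.factorial_ne_zero
    rw [poch_succ, poch_succ, mul_mul_mul_comm, ih,
      show 3 * (n + 1) = 3 * n + 1 + 1 + 1 by ring]
    simp only [Nat.factorial_succ]
    push_cast
    field_simp
    ring

lemma poch_summand_eq (n : ℕ) :
    (poch (1 / 2) n * poch (1 / 3) n * poch (2 / 3) n) / (poch 1 n) ^ 3 * (11 * (n : ℚ) + 3) *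
      (27 / 16 : ℚ) ^ n = (11 * n + 3) / 64 ^ n * ((2 * n).choose n) ^ 2 * (3 * n).choose n := by
  have hf (j : ℕ) : (j ! : ℚ) ≠ 0 := by exact_mod_cast j.factorial_ne_zero
  have h2 : ((2 * n).choose n : ℚ) = (2 * n)! / (n ! * n !) := by
    rw [two_mul, Nat.cast_add_choose]
  have h3 : ((3 * n).choose n : ℚ) = (3 * n)! / (n ! * (2 * n)!) := by
    rw [show 3 * n = n + 2 * n by ring, Nat.cast_add_choose]
  rw [mul_assoc (poch (1 / 2) n), poch_third_mul_poch_two_thirds, poch_half, poch_one, h2, h3,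
    div_pow, show (64 : ℚ) = 4 * 16 by norm_num, mul_pow]
  field_simp [hf]

theorem theorem1p3 (p : ℕ) (hp : p.Prime) (hp2 : 2 < p) :
    RatModEq (p ^ 3)
      (∑ n ∈ Finset.range p,
        (poch (1 / 2) n * poch (1 / 3) n * poch (2 / 3) n) / (poch 1 n) ^ 3
          * (11 * (n : ℚ) + 3) * (27 / 16 : ℚ) ^ n)
      (3 * (p : ℚ)) ∧
    RatModEq (p ^ 3)
      (∑ k ∈ Finset.range p,
        (11 * (k : ℚ) + 3) / (64 : ℚ) ^ k
          * (Nat.choose (2 * k) k : ℚ) ^ 2 * (Nat.choose (3 * k) k : ℚ))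
      (3 * (p : ℚ)) := by
  have h := ratModEq_sum_wzF_zero hp hp2
  simp only [wzF_zero] at h
  refine ⟨?_, h⟩
  rwa [sum_congr rfl fun n _ => poch_summand_eq n]
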